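/- Let $\Bbbk$ be a field, let $n \ge 1$ and $r_1,\dots,r_n \ge 2$ be integers, let $s,t \in [n]=\{1,\dots,n\}$, and put $\mathcal N=[r_1]\times\cdots\times[r_n]$. Two indices $a,b\in\mathcal N$ are *$s$-equivalent* if $\sum_{i=1}^s a_i=\sum_{i=1}^s b_i$ and $a_i=b_i$ for all $i>s$. The *normal form* $\overline a$ of $a$ is the lexicographically largest index that is $s$-equivalent to $a$. Let $R=\Bbbk[x_a : a\in\mathcal N]$ be the polynomial ring in variables indexed by $\mathcal N$ with $x_a=x_b$ exactly when $a,b$ are $s$-equivalent (so the distinct variables correspond to the indices in normal form). Order the variables by $x_a<x_b$ if and only if $\overline a<\overline b$ lexicographically, and give $R$ the corresponding lexicographic monomial order. For $L\subseteq[n]$ and $a,b\in\mathcal N$ let $\mathrm{sw}(L,a,b)\in\mathcal N$ be the index whose $i$th component is $b_i$ if $i\in L$ and $a_i$ if $i\notin L$, and put $f_{L,a,b}=x_ax_b-x_{\mathrm{sw}(L,a,b)}x_{\mathrm{sw}(L,b,a)}$ and $f_{i,a,b}=f_{\{i\},a,b}$. Let $\mathrm d(a,b)$ be the number of components in which $a$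 and $b$ differ. A set $\mathcal S\subseteq\mathcal N$ is *$(s,t)$-switchable* if (1) $\mathrm{sw}(\{i\},a,b)\in\mathcal S$ for all $a,b\in\mathcal S$ with $\mathrm d(a,b)=2$ and all $i\in[t]$, and (2) every index that is $s$-equivalent to an element of $\mathcal S$ lies in $\mathcal S$. Indices $a,b\in\mathcal S$ are *connected in $\mathcal S$* if there are $c_0=a,c_1,\dots,c_m=b$ in $\mathcal S$ ($m\ge 0$) with $\mathrm d(c_{j-1},c_j)=1$ for $1\le j\le m$. Let $\mathcal S\subseteq\mathcal N$ be any $(s,t)$-switchable set, and let $\tilde I_{\mathcal S}\subseteq R$ be the ideal generated by all $f_{i,a,b}$ with $i\in[t]$ and $a,b$ connected in $\mathcal S$. Then $$G_{\mathcal S}=\{f_{K,a,b} : K\subseteq[t],\ a,b \text{ connected in } \mathcal S\}$$ is a Gröbner basis of $\tilde I_{\mathcal S}$ with respect to this lexicographic order; that is, $G_{\mathcal S}$ is a finite set that generates $\tilde I_{\mathcal S}$, and the leading terms of the elements of $G_{\mathcal S}$ generate the ideal generated by the leading terms of all elements of $\tilde I_{\mathcal S}$ (with the leading term of $0$ taken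 to be $0$). -/

import Mathlib

noncomputable section

namespace HankelHypermatrix

/-- The set of indices `[r 0] × ⋯ × [r (n - 1)]`. Positions and entries are counted from `0`, so
position `i` and entry `v` here are position `i + 1` and entry `v + 1` in the usual notation; this
affects neither `s`-equivalence nor the lexicographic order. -/
abbrev Index {n : ℕ} (r : Fin n → ℕ) : Type := (i : Fin n) → Fin (r i)

variable {n : ℕ} {r : Fin n → ℕ}

/-- `s`-equivalence: the first `s` components have the same sum, the others agree. -/
def SEquiv (s : ℕ) (a b : Index r) : Prop :=
  (∑ i with i.val < s, (a i : ℕ)) = (∑ i with i.val < s, (b i : ℕ)) ∧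
    ∀ i : Fin n, s ≤ i.val → a i = b i

theorem SEquiv.refl (s : ℕ) (a : Index r) : SEquiv s a a := ⟨rfl, fun _ _ => rfl⟩

theorem SEquiv.symm {s : ℕ} {a b : Index r} (h : SEquiv s a b) : SEquiv s b a :=
  ⟨h.1.symm, fun i hi => (h.2 i hi).symm⟩

theorem SEquiv.trans {s : ℕ} {a b c : Index r} (h : SEquiv s a b) (h' : SEquiv s b c) :
    SEquiv s a c :=
  ⟨h.1.trans h'.1, fun i hi => (h.2 i hi).trans (h'.2 i hi)⟩

open Classical in
/-- The `s`-equivalence class of `a`, as a finite set of indices ordered lexicographically. -/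
def sClass (s : ℕ) (a : Index r) : Finset (Lex (Index r)) :=
  Finset.univ.filter fun a' => SEquiv s (ofLex a') a

theorem mem_sClass {s : ℕ} {a : Index r} {a' : Lex (Index r)} :
    a' ∈ sClass s a ↔ SEquiv s (ofLex a') a := by
  simp [sClass]

theorem sClass_nonempty (s : ℕ) (a : Index r) : (sClass s a).Nonempty :=
  ⟨toLex a, mem_sClass.2 (SEquiv.refl s a)⟩

/-- The normal form of an index: the lexicographically largest `s`-equivalent index. -/
def normalForm (s : ℕ) (a : Index r) : Lex (Index r) := (sClass s a).max' (sClass_nonempty s a)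

theorem normalForm_sEquiv (s : ℕ) (a : Index r) : SEquiv s (ofLex (normalForm s a)) a :=
  mem_sClass.1 (Finset.max'_mem _ (sClass_nonempty s a))

theorem normalForm_eq_of_sEquiv {s : ℕ} {a b : Index r} (h : SEquiv s a b) :
    normalForm s a = normalForm s b := by
  have : sClass s a = sClass s b := by
    ext c
    simp only [mem_sClass]
    exact ⟨fun hc => hc.trans h, fun hc => hc.trans h.symm⟩
  simp only [normalForm, this]

/-- The variables correspond to the indices in normal form. The order dual appears because
`MonomialOrder.lex` makes the variable of a smaller label larger, whereas here `x_a < x_b` is to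
hold when the normal form of `a` is smaller than that of `b`. -/
abbrev Var (r : Fin n → ℕ) (s : ℕ) : Type :=
  {a : Lex (Index r) // normalForm s (ofLex a) = a}ᵒᵈ

/-- The label of the variable `x_a`. -/
def var (s : ℕ) (a : Index r) : Var r s :=
  OrderDual.toDual ⟨normalForm s a, normalForm_eq_of_sEquiv (normalForm_sEquiv s a)⟩

/-- The entry `x_a` of the `s`-Hankel hypermatrix. -/
def x (k : Type*) [Field k] (s : ℕ) (a : Index r) : MvPolynomial (Var r s) k :=
  MvPolynomial.X (var s a)

/-- The switch of `a` and `b` with respect to `L`. -/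
def sw (L : Finset (Fin n)) (a b : Index r) : Index r := fun i => if i ∈ L then b i else a i

/-- The binomial `f_{L,a,b}`; for `L = {i}` it is the generalized minor `f_{i,a,b}`. -/
def f (k : Type*) [Field k] (s : ℕ) (L : Finset (Fin n)) (a b : Index r) :
    MvPolynomial (Var r s) k :=
  x k s a * x k s b - x k s (sw L a b) * x k s (sw L b a)

/-- `(s,t)`-switchable sets of indices. -/
structure IsSwitchable (s t : ℕ) (S : Set (Index r)) : Prop where
  sw_mem : ∀ a ∈ S, ∀ b ∈ S, hammingDist a b = 2 → ∀ i : Fin n, i.val < t → sw {i} a b ∈ S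
  sEquiv_mem : ∀ a ∈ S, ∀ b, SEquiv s b a → b ∈ S

/-- `a` and `b` lie in `S` and are joined by a path in `S` with steps of Hamming distance `1`. -/
def ConnectedIn (S : Set (Index r)) (a b : Index r) : Prop :=
  a ∈ S ∧ b ∈ S ∧
    Relation.ReflTransGen (fun c c' => c ∈ S ∧ c' ∈ S ∧ hammingDist c c' = 1) a b

/-- The ideal generated by the `f_{i,a,b}` with `i ∈ [t]` and `a`, `b` connected in `S`. -/
def tildeIdeal (k : Type*) [Field k] (s t : ℕ) (S : Set (Index r)) :
    Ideal (MvPolynomial (Var r s) k) :=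
  Ideal.span {p | ∃ (i : Fin n) (a b : Index r),
    i.val < t ∧ ConnectedIn S a b ∧ p = f k s {i} a b}

/-- The set of the `f_{K,a,b}` with `K ⊆ [t]` and `a`, `b` connected in `S`. -/
def groebnerSet (k : Type*) [Field k] (s t : ℕ) (S : Set (Index r)) :
    Set (MvPolynomial (Var r s) k) :=
  {p | ∃ (K : Finset (Fin n)) (a b : Index r),
    (∀ i ∈ K, i.val < t) ∧ ConnectedIn S a b ∧ p = f k s K a b}

/-- `G` is a Gröbner basis of `I`: a finite generating set whose leading terms generate the ideal
of all leading terms of elements of `I`. (The leading term of `0` is `0`, so `0 ∈ G` is allowed.) -/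
structure IsGroebnerBasis {σ k : Type*} [Field k] (m : MonomialOrder σ)
    (I : Ideal (MvPolynomial σ k)) (G : Set (MvPolynomial σ k)) : Prop where
  finite : G.Finite
  span_eq : Ideal.span G = I
  span_leadingTerm :
    Ideal.span (m.leadingTerm '' G) = Ideal.span (m.leadingTerm '' (I : Set (MvPolynomial σ k)))

end HankelHypermatrix

end

noncomputable section

namespace HankelHypermatrix

variable {n : ℕ} {r : Fin n → ℕ}

/-! Only those binomials `f_{K,a,b}` are used in which `x_a` exceeds both variables of the second
monomial; their leading monomial is then `x_a x_b`. Call a monomial standard if none of these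
divides it. It suffices that no nonzero element of the ideal has a standard leading monomial.

Weights on the variables that agree on both monomials of each generator split the monomials into
congruence classes. Summing coefficients over one class kills the ideal, so every monomial of an
element `g` of the ideal is congruent to another monomial of `g`
(`exists_congruent_of_mem_tildeIdeal`). The leading monomial is thus congruent to a smaller one, and
the task is to show that a standard monomial is minimal in its class (`IsStandard.not_congruent`).

Let `m` be standard, `m'` congruent and smaller, and `v` the largest variable in which they differ.
Among the variables not above `v` in its connected component, the weights conserve the total head
sum, the distribution of entries in each position from `s` on, and the distribution of whole tails
beyond `max s t`. The factors sharing with `v` the head sum, then one further position at a time,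
then the tail, are counted successively. Standardness makes the factors of `m` lost at each stage
lie among those counted before, so `m` loses the most possible and never has more than `m'`. At the
end this bounds the exponent of `v` in `m` by that in `m'`, a contradiction. -/

/-! ### Head sums and switches. -/

/-- A sum of naturals with prescribed lower and upper bounds takes every intermediate value. -/
theorem exists_sum_eq_of_le_of_le {ι : Type*} (A : Finset ι) (lo hi : ι → ℕ)
    (h : ∀ i ∈ A, lo i ≤ hi i) (c : ℕ) (hlo : ∑ i ∈ A, lo i ≤ c) (hhi : c ≤ ∑ i ∈ A, hi i) :
    ∃ y : ι → ℕ, (∀ i ∈ A, lo i ≤ y i ∧ y i ≤ hi i) ∧ ∑ i ∈ A, y i = c := by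
  classical
  induction A using Finset.induction_on generalizing c with
  | empty => exact ⟨lo, by simp, by simp at hhi ⊢; omega⟩
  | insert i A hi' ih =>
    rw [Finset.sum_insert hi'] at hlo hhi
    have h1 := h i (Finset.mem_insert_self _ _)
    have h2 : ∑ j ∈ A, lo j ≤ ∑ j ∈ A, hi j :=
      Finset.sum_le_sum fun j hj => h j (Finset.mem_insert_of_mem hj)
    obtain ⟨y, hy, hys⟩ := ih (fun j hj => h j (Finset.mem_insert_of_mem hj))
      (max (∑ j ∈ A, lo j) (c - hi i)) (by omega) (by omega)
    have hne : ∀ j ∈ A, j ≠ i := fun j hj e => hi' (e ▸ hj)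
    refine ⟨Function.update y i (c - ∑ j ∈ A, y j), fun j hj => ?_, ?_⟩
    · rcases Finset.mem_insert.1 hj with rfl | hj
      · simp only [Function.update_self]; omega
      · rw [Function.update_of_ne (hne j hj)]; exact hy j hj
    · rw [Finset.sum_insert hi', Function.update_self,
        Finset.sum_congr rfl fun j hj => Function.update_of_ne (hne j hj) _ _]
      omega

/-- The sum of the first `s` components. -/
def headSum (s : ℕ) (a : Index r) : ℕ := ∑ i with i.val < s, (a i : ℕ)

theorem SEquiv.headSum_eq {s : ℕ} {a b : Index r} (h : SEquiv s a b) :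
    headSum s a = headSum s b := h.1

theorem headSum_mono {s : ℕ} {a b : Index r} (h : ∀ i : Fin n, i.val < s → (a i : ℕ) ≤ b i) :
    headSum s a ≤ headSum s b :=
  Finset.sum_le_sum fun i hi => h i (by simpa using hi)

theorem headSum_le (s : ℕ) (a : Index r) :
    headSum s a ≤ ∑ i : Fin n with i.val < s, (r i - 1) :=
  Finset.sum_le_sum fun i _ => by have := (a i).2; omega

/-- An index with prescribed tail, prescribed sum of the first `s` components and prescribed bounds
on these components. -/
theorem exists_index {s : ℕ} (b : Index r) (lo hi : Fin n → ℕ) (h : ∀ i, lo i ≤ hi i)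
    (hr : ∀ i, hi i < r i) (c : ℕ) (hlo : ∑ i : Fin n with i.val < s, lo i ≤ c)
    (hhi : c ≤ ∑ i : Fin n with i.val < s, hi i) :
    ∃ a : Index r, headSum s a = c ∧ (∀ i : Fin n, i.val < s → lo i ≤ a i ∧ (a i : ℕ) ≤ hi i) ∧
      ∀ i : Fin n, s ≤ i.val → a i = b i := by
  obtain ⟨y, hy, hys⟩ := exists_sum_eq_of_le_of_le _ lo hi (fun i _ => h i) c hlo hhi
  have hy' : ∀ i : Fin n, i.val < s → y i < r i := fun i hi =>
    (hy i (by simpa using hi)).2.trans_lt (hr i)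
  refine ⟨fun i => if hi : i.val < s then ⟨y i, hy' i hi⟩ else b i, ?_, ?_, ?_⟩
  · rw [← hys]
    refine Finset.sum_congr rfl fun i hi => ?_
    have : i.val < s := by simpa using hi
    simp [this]
  · intro i hi
    simpa [hi] using hy i (by simpa using hi)
  · intro i hi
    simp [not_lt.2 hi]

theorem sw_apply_of_mem {K : Finset (Fin n)} {i : Fin n} (h : i ∈ K) (a b : Index r) :
    sw K a b i = b i := if_pos h

theorem sw_apply_of_notMem {K : Finset (Fin n)} {i : Fin n} (h : i ∉ K) (a b : Index r) :
    sw K a b i = a i := if_neg h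

theorem sw_insert {K : Finset (Fin n)} {i : Fin n} (a b : Index r) :
    sw (insert i K) a b = sw {i} (sw K a b) b := by
  funext j
  by_cases h : j = i <;> by_cases h' : j ∈ K <;> simp [sw, h, h']

theorem sw_insert' {K : Finset (Fin n)} {i : Fin n} (hi : i ∉ K) (a b : Index r) :
    sw (insert i K) a b = sw {i} (sw K a b) (sw K b a) := by
  funext j
  by_cases h : j = i
  · subst h; simp [sw, hi]
  · by_cases h' : j ∈ K <;> simp [sw, h, h']

/-- If exactly one of the first `s` positions is switched, the sum changes accordingly. -/
theorem headSum_sw {s : ℕ} {K : Finset (Fin n)} {p : Fin n} (hp : p.val < s) (hpK : p ∈ K)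
    (hK : ∀ i ∈ K, i.val < s → i = p) (a b : Index r) :
    headSum s (sw K a b) + a p = headSum s a + b p := by
  have hmem : p ∈ Finset.univ.filter fun i : Fin n => i.val < s := by simpa using hp
  have : ∑ i ∈ (Finset.univ.filter fun i : Fin n => i.val < s).erase p, (sw K a b i : ℕ) =
      ∑ i ∈ (Finset.univ.filter fun i : Fin n => i.val < s).erase p, (a i : ℕ) := by
    refine Finset.sum_congr rfl fun i hi => ?_
    simp only [Finset.mem_erase, Finset.mem_filter, Finset.mem_univ, true_and] at hi
    rw [sw_apply_of_notMem fun h => hi.1 (hK i h hi.2)]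
  rw [headSum, headSum, ← Finset.add_sum_erase _ _ hmem, ← Finset.add_sum_erase _ _ hmem, this,
    sw_apply_of_mem hpK]
  omega

theorem headSum_sw_of_le {s : ℕ} {K : Finset (Fin n)} (hK : ∀ i ∈ K, s ≤ i.val) (a b : Index r) :
    headSum s (sw K a b) = headSum s a := by
  refine Finset.sum_congr rfl fun i hi => ?_
  have : i.val < s := by simpa using hi
  rw [sw_apply_of_notMem fun h => by have := hK i h; omega]

/-- Switching a single position preserves the total head sum. -/
theorem headSum_sw_add {s : ℕ} (i : Fin n) (a b : Index r) :
    headSum s (sw {i} a b) + headSum s (sw {i} b a) = headSum s a + headSum s b := by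
  by_cases hi : i.val < s
  · have h1 := headSum_sw hi (Finset.mem_singleton_self i) (by simp) a b
    have h2 := headSum_sw hi (Finset.mem_singleton_self i) (by simp) b a
    omega
  · rw [headSum_sw_of_le (by simpa using hi), headSum_sw_of_le (by simpa using hi)]

/-! ### Connectedness under switches and `s`-equivalence. -/

namespace ConnectedIn

variable {S : Set (Index r)} {a b c : Index r}

theorem refl (h : a ∈ S) : ConnectedIn S a a := ⟨h, h, .refl⟩

theorem trans (h : ConnectedIn S a b) (h' : ConnectedIn S b c) : ConnectedIn S a c :=
  ⟨h.1, h'.2.1, h.2.2.trans h'.2.2⟩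

theorem symm (h : ConnectedIn S a b) : ConnectedIn S b a := by
  refine ⟨h.2.1, h.1, ?_⟩
  have h2 := h.2.2
  induction h2 with
  | refl => exact .refl
  | tail h1 h2 ih =>
    refine .trans (.single ⟨h2.2.1, h2.1, by rw [hammingDist_comm]; exact h2.2.2⟩) (ih ?_)
    exact ⟨h.1, h2.1, h1⟩

theorem of_hammingDist (ha : a ∈ S) (hb : b ∈ S) (h : hammingDist a b = 1) : ConnectedIn S a b :=
  ⟨ha, hb, .single ⟨ha, hb, h⟩⟩

/-- Elements of `S` differing in at most one position are connected. -/
theorem of_eq_off (ha : a ∈ S) (hb : b ∈ S) (p : Fin n) (h : ∀ i, i ≠ p → a i = b i) :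
    ConnectedIn S a b := by
  by_cases hp : a p = b p
  · obtain rfl : a = b := funext fun i => by
      by_cases hi : i = p
      · rw [hi, hp]
      · exact h i hi
    exact refl ha
  · refine of_hammingDist ha hb ?_
    rw [hammingDist, Finset.card_eq_one]
    refine ⟨p, ?_⟩
    ext i
    simp only [Finset.mem_filter, Finset.mem_univ, true_and, Finset.mem_singleton]
    exact ⟨fun hi => by_contra fun hip => hi (h i hip), fun hi => hi ▸ hp⟩

end ConnectedIn

namespace IsSwitchable

variable {s t : ℕ} {S : Set (Index r)} (hS : IsSwitchable s t S)
include hS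

/-- Elements of `S` differing at most in the positions `p` and `q` can be switched at `p`. -/
theorem sw_mem_of_eq_off {a b : Index r} (ha : a ∈ S) (hb : b ∈ S) {p q : Fin n} (hp : p.val < t)
    (h : ∀ i, i ≠ p → i ≠ q → a i = b i) : sw {p} a b ∈ S := by
  by_cases hap : a p = b p
  · have : sw {p} a b = a := by
      funext i
      by_cases hi : i = p
      · subst hi; simp [sw, hap]
      · simp [sw, hi]
    rwa [this]
  · by_cases hpq : ∀ i, i ≠ p → a i = b i
    · have : sw {p} a b = b := by
        funext i
        by_cases hi : i = p
        · subst hi; simp [sw]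
        · simp [sw, hi, hpq i hi]
      rwa [this]
    · push Not at hpq
      obtain ⟨j, hjp, hj⟩ := hpq
      have hjq : j = q := by_contra fun hjq => hj (h j hjp hjq)
      subst hjq
      refine hS.sw_mem a ha b hb ?_ p hp
      rw [hammingDist, Finset.card_eq_two]
      refine ⟨p, j, fun e => hjp e.symm, ?_⟩
      ext i
      simp only [Finset.mem_filter, Finset.mem_univ, true_and, Finset.mem_insert,
        Finset.mem_singleton]
      refine ⟨fun hi => ?_, ?_⟩
      · by_contra hc
        push Not at hc
        exact hi (h i hc.1 hc.2)
      · rintro (rfl | rfl) <;> assumption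

/-- Only membership in `S` is at stake. It is carried back along the path: for a step from `a` to
`c` at position `q`, the switch of `c` with `b` differs from `a` at most at `p` and `q`, so
switchability applies. -/
theorem connectedIn_sw_singleton {a b : Index r} (h : ConnectedIn S a b) {p : Fin n}
    (hp : p.val < t) : ConnectedIn S a (sw {p} a b) := by
  suffices sw {p} a b ∈ S from
    .of_eq_off h.1 this p fun i hi => by simp [sw, hi]
  obtain ⟨ha, hb, h⟩ := h
  induction h using Relation.ReflTransGen.head_induction_on with
  | refl =>
    convert ha using 1
    funext i
    simp [sw]
  | @head a c hac hcb ih =>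
    have hc' := ih hac.2.1
    obtain ⟨q, hq⟩ := Finset.card_eq_one.1 (show Finset.card _ = 1 from hac.2.2)
    have hq' : ∀ i, i ≠ q → a i = c i := fun i hi => by
      by_contra hne
      have : i ∈ ({q} : Finset (Fin n)) := by rw [← hq]; simpa using hne
      exact hi (by simpa using this)
    have := hS.sw_mem_of_eq_off ha hc' hp (q := q) (fun i hip hiq => by simp [sw, hip, hq' i hiq])
    convert this using 1
    funext i
    by_cases hi : i = p <;> simp [sw, hi]

theorem connectedIn_sw {a b : Index r} (h : ConnectedIn S a b) {K : Finset (Fin n)}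
    (hK : ∀ i ∈ K, i.val < t) : ConnectedIn S a (sw K a b) := by
  classical
  induction K using Finset.induction_on with
  | empty =>
    have : sw ∅ a b = a := by funext i; simp [sw]
    rw [this]
    exact .refl h.1
  | insert i K hi ih =>
    have h1 := ih fun j hj => hK j (Finset.mem_insert_of_mem hj)
    rw [sw_insert]
    exact h1.trans (hS.connectedIn_sw_singleton (h1.symm.trans h) (hK i (Finset.mem_insert_self _ _)))

/-- Elements of `S` differing at most in the positions `p` and `q`, one of them in `[t]`, are
connected. -/
theorem connectedIn_of_eq_off {a b : Index r} (ha : a ∈ S) (hb : b ∈ S) {p q : Fin n}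
    (hp : p.val < t) (h : ∀ i, i ≠ p → i ≠ q → a i = b i) : ConnectedIn S a b := by
  have hm := hS.sw_mem_of_eq_off ha hb hp h
  refine (ConnectedIn.of_eq_off ha hm p fun i hi => by simp [sw, hi]).trans
    (.of_eq_off hm hb q fun i hi => ?_)
  by_cases hip : i = p
  · simp [sw, hip]
  · simp [sw, hip, h i hip hi]

end IsSwitchable

/-- Move one unit from position `j` to position `i`. -/
def moveUnit (a : Index r) (i j : Fin n) (hi : (a i : ℕ) + 1 < r i) : Index r :=
  Function.update (Function.update a j ⟨a j - 1, by have := (a j).2; omega⟩) i ⟨a i + 1, hi⟩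

theorem moveUnit_self (a : Index r) (i j : Fin n) (hi : (a i : ℕ) + 1 < r i) :
    (moveUnit a i j hi i : ℕ) = a i + 1 := by simp [moveUnit]

theorem moveUnit_source {a : Index r} {i j : Fin n} (hij : i ≠ j) (hi : (a i : ℕ) + 1 < r i) :
    (moveUnit a i j hi j : ℕ) = a j - 1 := by simp [moveUnit, hij.symm]

theorem moveUnit_of_ne {a : Index r} {i j l : Fin n} (hi : (a i : ℕ) + 1 < r i) (hli : l ≠ i)
    (hlj : l ≠ j) : moveUnit a i j hi l = a l := by simp [moveUnit, hli, hlj]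

theorem moveUnit_sEquiv {s : ℕ} {a : Index r} {i j : Fin n} (his : i.val < s) (hjs : j.val < s)
    (hij : i ≠ j) (hi : (a i : ℕ) + 1 < r i) (hj : 0 < (a j : ℕ)) :
    SEquiv s (moveUnit a i j hi) a := by
  refine ⟨?_, fun l hl => moveUnit_of_ne hi (by rintro rfl; omega) (by rintro rfl; omega)⟩
  have hmi : i ∈ Finset.univ.filter fun i : Fin n => i.val < s := by simpa using his
  have hmj : j ∈ (Finset.univ.filter fun i : Fin n => i.val < s).erase i := by
    simpa using ⟨hij.symm, hjs⟩
  rw [← Finset.add_sum_erase _ _ hmi, ← Finset.add_sum_erase _ _ hmj,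
    ← Finset.add_sum_erase _ _ hmi, ← Finset.add_sum_erase _ _ hmj, moveUnit_self,
    moveUnit_source hij, Finset.sum_congr rfl fun l hl => by
      simp only [Finset.mem_erase] at hl
      rw [moveUnit_of_ne hi hl.2.1 hl.1]]
  omega

namespace IsSwitchable

variable {s t : ℕ} {S : Set (Index r)} (hS : IsSwitchable s t S)
include hS

theorem connectedIn_moveUnit_of_lt {a : Index r} (ha : a ∈ S) {i j : Fin n} (his : i.val < s)
    (hjs : j.val < s) (hij : i ≠ j) (ht : i.val < t ∨ j.val < t) (hi : (a i : ℕ) + 1 < r i)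
    (hj : 0 < (a j : ℕ)) : ConnectedIn S a (moveUnit a i j hi) := by
  have hm := hS.sEquiv_mem a ha _ (moveUnit_sEquiv his hjs hij hi hj)
  rcases ht with h | h
  · exact hS.connectedIn_of_eq_off ha hm h fun l h1 h2 => (moveUnit_of_ne hi h1 h2).symm
  · exact hS.connectedIn_of_eq_off ha hm h fun l h1 h2 => (moveUnit_of_ne hi h2 h1).symm

/-- If neither position lies in `[t]`, the unit travels through the first position, which does. -/
theorem connectedIn_moveUnit (hr : ∀ i, 2 ≤ r i) (ht : 1 ≤ t) {a : Index r} (ha : a ∈ S)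
    {i j : Fin n} (his : i.val < s) (hjs : j.val < s) (hij : i ≠ j) (hi : (a i : ℕ) + 1 < r i)
    (hj : 0 < (a j : ℕ)) : ConnectedIn S a (moveUnit a i j hi) := by
  by_cases hti : i.val < t ∨ j.val < t
  · exact hS.connectedIn_moveUnit_of_lt ha his hjs hij hti hi hj
  push Not at hti
  obtain ⟨p, hp⟩ : ∃ p : Fin n, p.val = 0 := ⟨⟨0, by have := i.2; omega⟩, rfl⟩
  have hip : i ≠ p := by rintro rfl; omega
  have hjp : j ≠ p := by rintro rfl; omega
  have hps : p.val < s := by omega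
  have hpt : p.val < t := by omega
  -- An empty position `p` has room because `r p ≥ 2`, so it receives first; otherwise it gives
  -- first.
  by_cases h0 : (a p : ℕ) = 0
  · have hp1 : (a p : ℕ) + 1 < r p := by have := hr p; omega
    have h1 := hS.connectedIn_moveUnit_of_lt ha hps hjs hjp.symm (.inl hpt) hp1 hj
    have e1 := moveUnit_of_ne (l := i) hp1 hip hij
    have hi' : (moveUnit a p j hp1 i : ℕ) + 1 < r i := by rw [e1]; exact hi
    have h2 := hS.connectedIn_moveUnit_of_lt h1.2.1 his hps hip (.inr hpt) hi'
      (by rw [moveUnit_self]; omega)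
    convert h1.trans h2 using 1
    funext l
    apply Fin.ext
    by_cases hli : l = i
    · subst hli; rw [moveUnit_self, moveUnit_self, e1]
    by_cases hlj : l = j
    · subst hlj
      rw [moveUnit_source hij, moveUnit_of_ne hi' hli hjp, moveUnit_source hjp.symm]
    rw [moveUnit_of_ne hi hli hlj]
    by_cases hlp : l = p
    · subst hlp
      rw [moveUnit_source hip, moveUnit_self]; omega
    · rw [moveUnit_of_ne hi' hli hlp, moveUnit_of_ne hp1 hlp hlj]
  · have h1 := hS.connectedIn_moveUnit_of_lt ha his hps hip (.inr hpt) hi (by omega)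
    have e1 := moveUnit_source (a := a) hip hi
    have hp1 : (moveUnit a i p hi p : ℕ) + 1 < r p := by have := (a p).2; rw [e1]; omega
    have e2 := moveUnit_of_ne (l := j) hi hij.symm hjp
    have h2 := hS.connectedIn_moveUnit_of_lt h1.2.1 hps hjs hjp.symm (.inl hpt) hp1
      (by rw [e2]; omega)
    convert h1.trans h2 using 1
    funext l
    apply Fin.ext
    by_cases hli : l = i
    · subst hli; rw [moveUnit_self, moveUnit_of_ne hp1 hip hij, moveUnit_self]
    by_cases hlj : l = j
    · subst hlj
      rw [moveUnit_source hij, moveUnit_source hjp.symm, e2]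
    rw [moveUnit_of_ne hi hli hlj]
    by_cases hlp : l = p
    · subst hlp
      rw [moveUnit_self, e1]; omega
    · rw [moveUnit_of_ne hp1 hlp hlj, moveUnit_of_ne hi hli hlp]

theorem connectedIn_of_sEquiv (hr : ∀ i, 2 ≤ r i) (ht : 1 ≤ t) {a b : Index r} (ha : a ∈ S)
    (hab : SEquiv s a b) : ConnectedIn S a b := by
  -- The truncated differences measure the total deficit of `a` against `b`; moving a unit from a
  -- surplus to a deficit lowers it.
  induction hN : ∑ i : Fin n, ((b i : ℕ) - a i) using Nat.strong_induction_on generalizing a with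
  | _ N ih =>
  by_cases hle : ∀ i : Fin n, i.val < s → (b i : ℕ) ≤ a i
  · obtain rfl : a = b := by
      funext i
      by_cases hi : i.val < s
      · have := (Finset.sum_eq_sum_iff_of_le (s := Finset.univ.filter fun i : Fin n => i.val < s)
          (f := fun i => (b i : ℕ)) (g := fun i => (a i : ℕ))
          (fun i hi => hle i (by simpa using hi))).1 hab.1.symm i (by simpa using hi)
        exact Fin.ext this.symm
      · exact hab.2 i (by omega)
    exact .refl ha
  · have hge : ¬ ∀ i : Fin n, i.val < s → (a i : ℕ) ≤ b i := fun h => hle fun i hi => by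
      have := (Finset.sum_eq_sum_iff_of_le (s := Finset.univ.filter fun i : Fin n => i.val < s)
          (f := fun i => (a i : ℕ)) (g := fun i => (b i : ℕ))
          (fun i hi => h i (by simpa using hi))).1 hab.1 i (by simpa using hi)
      omega
    push Not at hle hge
    obtain ⟨i, his, hi⟩ := hle
    obtain ⟨j, hjs, hj⟩ := hge
    have hij : i ≠ j := by rintro rfl; omega
    have hi1 : (a i : ℕ) + 1 < r i := by have := (b i).2; omega
    have hj0 : 0 < (a j : ℕ) := by omega
    have h1 := hS.connectedIn_moveUnit hr ht ha his hjs hij hi1 hj0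
    refine h1.trans (ih _ ?_ h1.2.1 ((moveUnit_sEquiv his hjs hij hi1 hj0).trans hab) rfl)
    rw [← hN]
    refine Finset.sum_lt_sum (fun l _ => ?_) ⟨i, Finset.mem_univ i, ?_⟩
    · by_cases hli : l = i
      · subst hli; rw [moveUnit_self]; omega
      by_cases hlj : l = j
      · subst hlj; rw [moveUnit_source hij]; omega
      rw [moveUnit_of_ne hi1 hli hlj]
    · rw [moveUnit_self]; omega

end IsSwitchable

/-! ### Comparison of variables: head sum first, then the tail lexicographically. -/

theorem toLex_lt_toLex_iff {a b : Index r} :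
    toLex a < toLex b ↔ ∃ i, (∀ j < i, a j = b j) ∧ a i < b i := Iff.rfl

theorem le_normalForm {s : ℕ} {a b : Index r} (h : SEquiv s b a) : toLex b ≤ normalForm s a :=
  Finset.le_max' _ _ (mem_sClass.2 h)

theorem normalForm_lt_of_headSum_lt {s : ℕ} {a b : Index r} (h : headSum s a < headSum s b) :
    normalForm s a < normalForm s b := by
  set a' : Index r := ofLex (normalForm s a) with ha'
  have hsa : headSum s a' = headSum s a := (normalForm_sEquiv s a).headSum_eq
  -- Lower bounds taken from `a'` make every change within the head an increase, whatever the tail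
  -- of `b` is.
  obtain ⟨b', hb's, hb'l, hb't⟩ := exists_index (s := s) b (fun i => a' i) (fun i => r i - 1)
    (fun i => by have := (a' i).2; omega) (fun i => by have := (a' i).2; omega) (headSum s b)
    (by rw [← headSum, hsa]; exact h.le) (headSum_le s b)
  refine lt_of_lt_of_le ?_ (le_normalForm (b := b') ⟨hb's, hb't⟩)
  have hex : ∃ i : Fin n, i.val < s ∧ a' i < b' i := by
    by_contra hc
    push Not at hc
    have := headSum_mono (s := s) (a := b') (b := a') hc
    omega
  classical
  have hne : (Finset.univ.filter fun i : Fin n => i.val < s ∧ a' i < b' i).Nonempty := by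
    obtain ⟨i, hi⟩ := hex
    exact ⟨i, by simpa using hi⟩
  obtain ⟨i, hi, hmin⟩ := Finset.exists_min_image _ id hne
  simp only [Finset.mem_filter, Finset.mem_univ, true_and, id] at hi hmin
  change toLex a' < toLex b'
  refine toLex_lt_toLex_iff.2 ⟨i, fun j hj => ?_, hi.2⟩
  have hjs : j.val < s := lt_trans hj hi.1
  have h1 := (hb'l j hjs).1
  by_contra hne'
  exact absurd (hmin j ⟨hjs, lt_of_le_of_ne h1 hne'⟩) (not_le.2 hj)

/-- The head of the normal form of `a` may be placed before the tail of `b`. -/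
theorem normalForm_lt_of_tail_lt {s : ℕ} {a b : Index r} {j : Fin n}
    (h : headSum s a = headSum s b) (hj : s ≤ j.val)
    (heq : ∀ i : Fin n, s ≤ i.val → i < j → a i = b i) (hlt : a j < b j) :
    normalForm s a < normalForm s b := by
  set a' : Index r := ofLex (normalForm s a) with ha'
  have hea : SEquiv s a' a := normalForm_sEquiv s a
  let b' : Index r := fun i => if i.val < s then a' i else b i
  have hb' : SEquiv s b' b := by
    refine ⟨?_, fun i hi => by simp [b', not_lt.2 hi]⟩
    refine Eq.trans ?_ (hea.1.trans h)
    refine Finset.sum_congr rfl fun i hi => ?_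
    have : i.val < s := by simpa using hi
    simp [b', this]
  refine lt_of_lt_of_le ?_ (le_normalForm hb')
  change toLex a' < toLex b'
  refine toLex_lt_toLex_iff.2 ⟨j, fun i hi => ?_, ?_⟩
  · by_cases his : i.val < s
    · simp [b', his]
    · simp only [b', if_neg his]
      rw [hea.2 i (by omega), heq i (by omega) hi]
  · simp only [b', if_neg (not_lt.2 hj)]
    rw [hea.2 j hj]
    exact hlt

/-- The index in normal form labelling a variable. -/
def idx {s : ℕ} (v : Var r s) : Index r := ofLex (OrderDual.ofDual v).1

theorem idx_var_sEquiv (s : ℕ) (a : Index r) : SEquiv s (idx (var s a)) a := normalForm_sEquiv s a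

theorem var_eq_of_sEquiv {s : ℕ} {a b : Index r} (h : SEquiv s a b) : var s a = var s b := by
  simp only [var, normalForm_eq_of_sEquiv h]

theorem var_idx {s : ℕ} (v : Var r s) : var s (idx v) = v :=
  OrderDual.ofDual.injective (Subtype.ext (OrderDual.ofDual v).2)

theorem var_eq_iff {s : ℕ} {a : Index r} {v : Var r s} : var s a = v ↔ SEquiv s a (idx v) :=
  ⟨by rintro rfl; exact (idx_var_sEquiv s a).symm,
    fun h => (var_eq_of_sEquiv h).trans (var_idx v)⟩

theorem var_lt_var_iff {s : ℕ} {a b : Index r} :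
    var s a < var s b ↔ normalForm s b < normalForm s a := Iff.rfl

/-- The larger head sum gives the larger entry, hence the smaller label. -/
theorem var_lt_of_headSum_lt {s : ℕ} {a b : Index r} (h : headSum s a < headSum s b) :
    var s b < var s a := var_lt_var_iff.2 (normalForm_lt_of_headSum_lt h)

theorem var_lt_of_tail_lt {s : ℕ} {a b : Index r} {j : Fin n}
    (h : headSum s a = headSum s b) (hj : s ≤ j.val)
    (heq : ∀ i : Fin n, s ≤ i.val → i < j → a i = b i) (hlt : a j < b j) :
    var s b < var s a := var_lt_var_iff.2 (normalForm_lt_of_tail_lt h hj heq hlt)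

/-! ### Leading terms and generation of the ideal. -/

section Polynomials

variable (k : Type*) [Field k]

theorem f_eq_monomial (s : ℕ) (K : Finset (Fin n)) (a b : Index r) :
    f k s K a b =
      MvPolynomial.monomial (Finsupp.single (var s a) 1 + Finsupp.single (var s b) 1) 1 -
      MvPolynomial.monomial
        (Finsupp.single (var s (sw K a b)) 1 + Finsupp.single (var s (sw K b a)) 1) 1 := by
  simp [f, x, MvPolynomial.X, MvPolynomial.monomial_mul]

theorem leadingTerm_f {s : ℕ} {K : Finset (Fin n)} {a b : Index r}
    (h1 : var s a < var s (sw K a b)) (h2 : var s a < var s (sw K b a)) :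
    MonomialOrder.lex.leadingTerm (f k s K a b) =
      MvPolynomial.monomial (Finsupp.single (var s a) 1 + Finsupp.single (var s b) 1) 1 := by
  classical
  have hdeg : ∀ d : Var r s →₀ ℕ,
      MonomialOrder.lex.degree (MvPolynomial.monomial d (1 : k)) = d := fun d => by
    rw [MonomialOrder.degree_monomial, if_neg one_ne_zero]
  have hlt : MonomialOrder.lex.toSyn (MonomialOrder.lex.degree (MvPolynomial.monomial
        (Finsupp.single (var s (sw K a b)) 1 + Finsupp.single (var s (sw K b a)) 1) (1 : k))) <
      MonomialOrder.lex.toSyn (MonomialOrder.lex.degree (MvPolynomial.monomial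
        (Finsupp.single (var s a) 1 + Finsupp.single (var s b) 1) (1 : k))) := by
    rw [hdeg, hdeg, MonomialOrder.lex_lt_iff, Finsupp.Lex.lt_iff]
    -- `x_b` may exceed `x_a`; the larger of the two, with the smaller label, decides.
    refine ⟨min (var s a) (var s b), fun j hj => ?_, ?_⟩
    · have ha : j < var s a := lt_of_lt_of_le hj (min_le_left _ _)
      have hb : j < var s b := lt_of_lt_of_le hj (min_le_right _ _)
      simp [ha.ne', hb.ne', (ha.trans h1).ne', (ha.trans h2).ne']
    · have h3 := lt_of_le_of_lt (min_le_left (var s a) (var s b)) h1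
      have h4 := lt_of_le_of_lt (min_le_left (var s a) (var s b)) h2
      rcases min_choice (var s a) (var s b) with h | h <;> rw [h] at h3 h4 ⊢ <;>
        simp [Finsupp.single_apply, h3.ne', h4.ne']
  rw [f_eq_monomial, MonomialOrder.leadingTerm, MonomialOrder.degree_sub_of_lt hlt,
    MonomialOrder.leadingCoeff_sub_of_lt hlt, hdeg, MonomialOrder.leadingCoeff_monomial]

/-- Switching one position after another telescopes, which puts every `f_{K,a,b}` into the ideal. -/
theorem f_insert {s : ℕ} {K : Finset (Fin n)} {i : Fin n} (hi : i ∉ K) (a b : Index r) :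
    f k s (insert i K) a b = f k s K a b + f k s {i} (sw K a b) (sw K b a) := by
  simp only [f, sw_insert' hi]
  ring

variable {s t : ℕ} {S : Set (Index r)}

theorem f_mem_tildeIdeal (hS : IsSwitchable s t S) {K : Finset (Fin n)} (hK : ∀ i ∈ K, i.val < t)
    {a b : Index r} (h : ConnectedIn S a b) : f k s K a b ∈ tildeIdeal k s t S := by
  classical
  induction K using Finset.induction_on with
  | empty =>
    have h1 : sw ∅ a b = a := by funext i; simp [sw]
    have h2 : sw ∅ b a = b := by funext i; simp [sw]
    simp [f, h1, h2]
  | insert i K hi ih =>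
    have hK' : ∀ j ∈ K, j.val < t := fun j hj => hK j (Finset.mem_insert_of_mem hj)
    rw [f_insert k hi]
    exact Ideal.add_mem _ (ih hK') (Ideal.subset_span ⟨i, _, _, hK i (Finset.mem_insert_self _ _),
      ((hS.connectedIn_sw h hK').symm.trans h).trans (hS.connectedIn_sw h.symm hK'), rfl⟩)

theorem span_groebnerSet (hS : IsSwitchable s t S) :
    Ideal.span (groebnerSet k s t S) = tildeIdeal k s t S := by
  apply le_antisymm
  · rw [Ideal.span_le]
    rintro _ ⟨K, a, b, hK, h, rfl⟩
    exact f_mem_tildeIdeal k hS hK h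
  · refine Ideal.span_mono ?_
    rintro _ ⟨i, a, b, hi, h, rfl⟩
    exact ⟨{i}, a, b, by simpa using hi, h, rfl⟩

theorem groebnerSet_finite : (groebnerSet k s t S).Finite := by
  refine (Set.finite_range fun q : Finset (Fin n) × Index r × Index r =>
    f k s q.1 q.2.1 q.2.2).subset ?_
  rintro _ ⟨K, a, b, -, -, rfl⟩
  exact ⟨(K, a, b), rfl⟩

end Polynomials

/-! ### Invariant weights and congruence of monomials. -/

/-- Weights on the variables that take the same value on both monomials of every generator. -/
def IsInvariant (s t : ℕ) (S : Set (Index r)) (h : Var r s → ℤ) : Prop :=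
  ∀ (i : Fin n) (a b : Index r), i.val < t → ConnectedIn S a b →
    h (var s a) + h (var s b) = h (var s (sw {i} a b)) + h (var s (sw {i} b a))

/-- The weight of a monomial. -/
def weight {σ : Type*} [Fintype σ] (h : σ → ℤ) (m : σ →₀ ℕ) : ℤ := ∑ e, (m e : ℤ) * h e

theorem weight_add {σ : Type*} [Fintype σ] (h : σ → ℤ) (m m' : σ →₀ ℕ) :
    weight h (m + m') = weight h m + weight h m' := by
  simp [weight, add_mul, Finset.sum_add_distrib]

theorem weight_single {σ : Type*} [Fintype σ] (h : σ → ℤ) (v : σ) :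
    weight h (Finsupp.single v 1) = h v := by
  classical
  simp [weight, Finsupp.single_apply]

/-- Two monomials are congruent if all invariant weights agree on them. -/
def Congruent (s t : ℕ) (S : Set (Index r)) (m m' : Var r s →₀ ℕ) : Prop :=
  ∀ h, IsInvariant s t S h → weight h m = weight h m'

/-- No monomial of an element of the ideal is alone in its congruence class. -/
theorem exists_congruent_of_mem_tildeIdeal {k : Type*} [Field k] {s t : ℕ} {S : Set (Index r)}
    {g : MvPolynomial (Var r s) k} (hg : g ∈ tildeIdeal k s t S) {m : Var r s →₀ ℕ}
    (hm : m ∈ g.support) : ∃ m' ∈ g.support, m' ≠ m ∧ Congruent s t S m m' := by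
  classical
  -- The sum of the coefficients over the congruence class of `m`.
  let L : MvPolynomial (Var r s) k →ₗ[k] k :=
    (MvPolynomial.basisMonomials (Var r s) k).constr k
      fun m' => if Congruent s t S m m' then 1 else 0
  have hL : ∀ (d : Var r s →₀ ℕ) (c : k),
      L (MvPolynomial.monomial d c) = if Congruent s t S m d then c else 0 := by
    intro d c
    have h1 : MvPolynomial.monomial d c = c • MvPolynomial.basisMonomials (Var r s) k d := by
      simp [MvPolynomial.smul_monomial]
    rw [h1, map_smul, Module.Basis.constr_basis]
    simp
  have hzero : ∀ q : MvPolynomial (Var r s) k, L (q * g) = 0 := by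
    refine Submodule.span_induction (p := fun g _ => ∀ q : MvPolynomial (Var r s) k,
      L (q * g) = 0) ?_ ?_ ?_ ?_ hg
    · rintro _ ⟨i, a, b, hi, hab, rfl⟩ q
      induction q using MvPolynomial.induction_on' with
      | add p q hp hq => rw [add_mul, map_add, hp, hq, add_zero]
      | monomial u c =>
        rw [f_eq_monomial, mul_sub, MvPolynomial.monomial_mul, MvPolynomial.monomial_mul, map_sub,
          hL, hL]
        have : Congruent s t S m
              (u + (Finsupp.single (var s a) 1 + Finsupp.single (var s b) 1)) ↔
            Congruent s t S m (u + (Finsupp.single (var s (sw {i} a b)) 1 +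
              Finsupp.single (var s (sw {i} b a)) 1)) := by
          refine forall₂_congr fun h hh => ?_
          simp only [weight_add, weight_single, hh i a b hi hab]
        simp only [this, sub_self]
    · intro q; simp
    · intro g g' _ _ hg hg' q
      rw [mul_add, map_add, hg, hg', add_zero]
    · intro p g _ hg q
      rw [smul_eq_mul, ← mul_assoc, hg]
  by_contra hc
  push Not at hc
  have h1 := hzero 1
  rw [one_mul, ← MvPolynomial.support_sum_monomial_coeff g, map_sum,
    Finset.sum_eq_single m] at h1
  · rw [hL, if_pos (show Congruent s t S m m from fun _ _ => rfl)] at h1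
    exact MvPolynomial.mem_support_iff.1 hm h1
  · intro m' hm' hne
    rw [hL, if_neg (hc m' hm' hne)]
  · exact fun h => absurd hm h

/-! ### Choice of representatives with a prescribed entry at `p`. -/

section Representatives

variable {s : ℕ} {p : Fin n}

/-- The largest possible sum of the components other than `p` among the first `s` ones. -/
def restMax (r : Fin n → ℕ) (s : ℕ) (p : Fin n) : ℕ :=
  ∑ i ∈ (Finset.univ.filter fun i : Fin n => i.val < s).erase p, (r i - 1)

theorem headSum_le_restMax (hp : p.val < s) (a : Index r) :
    headSum s a ≤ r p - 1 + restMax r s p := by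
  have hmem : p ∈ Finset.univ.filter fun i : Fin n => i.val < s := by simpa using hp
  rw [restMax, Finset.add_sum_erase _ (fun i => r i - 1) hmem]
  exact headSum_le s a

theorem exists_sEquiv_apply_eq (hp : p.val < s) (a : Index r) {c : ℕ} (hc : c < r p)
    (h1 : c ≤ headSum s a) (h2 : headSum s a ≤ c + restMax r s p) :
    ∃ a' : Index r, SEquiv s a' a ∧ (a' p : ℕ) = c := by
  have hmem : p ∈ Finset.univ.filter fun i : Fin n => i.val < s := by simpa using hp
  obtain ⟨a', h, hl, ht⟩ := exists_index (s := s) a (fun i => if i = p then c else 0)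
    (fun i => if i = p then c else r i - 1) (fun i => by split_ifs <;> omega)
    (fun i => by
      have := (a i).2
      split_ifs with hi
      · subst hi; exact hc
      · omega) (headSum s a) (by simpa [Finset.sum_ite_eq', hp] using h1) (by
      refine h2.trans (le_of_eq ?_)
      rw [← Finset.add_sum_erase _ _ hmem, if_pos rfl, restMax]
      congr 1
      refine Finset.sum_congr rfl fun i hi => ?_
      rw [if_neg (Finset.mem_erase.1 hi).1])
  refine ⟨a', ⟨h, ht⟩, ?_⟩
  have := hl p hp
  simp only [if_true] at this
  omega

/-- Head sums differing by at least two can be brought strictly closer by switching `p`. -/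
theorem exists_sEquiv_of_add_two_le (hp : p.val < s) (hrp : 2 ≤ r p) (hM : 1 ≤ restMax r s p) {a b : Index r}
    (h : headSum s b + 2 ≤ headSum s a) :
    ∃ a' b' : Index r, SEquiv s a' a ∧ SEquiv s b' b ∧ (b' p : ℕ) < a' p ∧
      (a' p : ℕ) + headSum s b < b' p + headSum s a := by
  have ha := headSum_le_restMax hp a
  have hr := (a p).2
  -- The least possible entries could differ by the full difference of head sums; the extra unit
  -- makes the difference strictly smaller, and `restMax ≥ 1` leaves room for it.
  let β := headSum s b + 1 - restMax r s p
  let α := max (β + 1) (headSum s a - restMax r s p)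
  obtain ⟨a', ha', ha'p⟩ := exists_sEquiv_apply_eq hp a (c := α) (by omega) (by omega) (by omega)
  obtain ⟨b', hb', hb'p⟩ := exists_sEquiv_apply_eq hp b (c := β) (by omega) (by omega) (by omega)
  exact ⟨a', b', ha', hb', by omega, by omega⟩

/-- Head sums can be interchanged by switching `p`. -/
theorem exists_sEquiv_of_le_add_one (hp : p.val < s) (hrp : 2 ≤ r p) {a b : Index r}
    (h : headSum s b ≤ headSum s a)
    (h' : restMax r s p = 0 ∨ headSum s a ≤ headSum s b + 1) :
    ∃ a' b' : Index r, SEquiv s a' a ∧ SEquiv s b' b ∧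
      (a' p : ℕ) + headSum s b = b' p + headSum s a := by
  have ha := headSum_le_restMax hp a
  have hr := (a p).2
  -- The least possible entry of `b`. If it is truncated to `0`, the assumption on the difference
  -- keeps `α` below `r p`.
  let β := headSum s b - restMax r s p
  let α := β + (headSum s a - headSum s b)
  obtain ⟨a', ha', ha'p⟩ := exists_sEquiv_apply_eq hp a (c := α) (by omega) (by omega) (by omega)
  obtain ⟨b', hb', hb'p⟩ := exists_sEquiv_apply_eq hp b (c := β) (by omega) (by omega) (by omega)
  exact ⟨a', b', ha', hb', by omega⟩

theorem one_le_restMax (hr : ∀ i, 2 ≤ r i) (hs : 2 ≤ s) (hsn : s ≤ n) (hp : p.val = 0) :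
    1 ≤ restMax r s p := by
  have hmem : (⟨1, by omega⟩ : Fin n) ∈
      (Finset.univ.filter fun i : Fin n => i.val < s).erase p := by
    simp only [Finset.mem_erase, Finset.mem_filter, Finset.mem_univ, true_and]
    exact ⟨fun h => by simp [← h] at hp, by omega⟩
  have := Finset.single_le_sum (f := fun i => r i - 1) (fun i _ => Nat.zero_le _) hmem
  have h2 := hr ⟨1, by omega⟩
  simp only [restMax]
  omega

theorem restMax_one (hp : p.val = 0) : restMax r 1 p = 0 := by
  refine Finset.sum_eq_zero fun i hi => ?_
  simp only [Finset.mem_erase, Finset.mem_filter, Finset.mem_univ, true_and] at hi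
  exact absurd (Fin.ext (by omega)) hi.1

theorem headSum_one (hp : p.val = 0) (a : Index r) : headSum 1 a = a p := by
  have : (Finset.univ.filter fun i : Fin n => i.val < 1) = {p} := by
    ext i
    simp only [Finset.mem_filter, Finset.mem_univ, true_and, Finset.mem_singleton, Fin.ext_iff]
    omega
  rw [headSum, this, Finset.sum_singleton]

end Representatives

/-! ### First disagreement between two variables. -/

section Order

variable {s : ℕ} {v e : Var r s}

theorem headSum_idx_le (h : v ≤ e) : headSum s (idx e) ≤ headSum s (idx v) := by
  by_contra hc
  have := var_lt_of_headSum_lt (not_le.1 hc)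
  rw [var_idx, var_idx] at this
  exact absurd h (not_le.2 this)

/-- Same head sum and same components at the positions from `s` to `j - 1`. -/
def AgreeUpTo (s j : ℕ) (a b : Index r) : Prop :=
  headSum s a = headSum s b ∧ ∀ i : Fin n, s ≤ i.val → i.val < j → a i = b i

theorem AgreeUpTo.apply_le (h : v ≤ e) {j : Fin n} (hj : s ≤ j.val)
    (hT : AgreeUpTo s j (idx e) (idx v)) : idx e j ≤ idx v j := by
  by_contra hc
  have := var_lt_of_tail_lt hT.1.symm hj (fun i hi hij => (hT.2 i hi hij).symm) (not_le.1 hc)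
  rw [var_idx, var_idx] at this
  exact absurd h (not_le.2 this)

theorem AgreeUpTo.exists_lt (h : v ≤ e) {i l : ℕ} (hi : s ≤ i) (hT : AgreeUpTo s i (idx e) (idx v))
    (hl : ¬ AgreeUpTo s l (idx e) (idx v)) :
    ∃ j : Fin n, i ≤ j.val ∧ j.val < l ∧ AgreeUpTo s j (idx e) (idx v) ∧ idx e j < idx v j := by
  classical
  have hex : ∃ j, AgreeUpTo s j (idx e) (idx v) ∧ i ≤ j ∧ ¬ AgreeUpTo s (j + 1) (idx e) (idx v) := by
    by_contra hc
    push Not at hc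
    have hall : ∀ d, AgreeUpTo s (i + d) (idx e) (idx v) := fun d => by
      induction d with
      | zero => exact hT
      | succ d ih => exact hc _ ih (Nat.le_add_right i d)
    exact hl ⟨hT.1, fun a ha hal => (hall l).2 a ha (by omega)⟩
  obtain ⟨j, hj, hij, hj1⟩ := hex
  have hjn : ∃ j' : Fin n, j'.val = j ∧ idx e j' ≠ idx v j' := by
    by_contra hc
    push Not at hc
    refine hj1 ⟨hj.1, fun a ha haj => ?_⟩
    rcases Nat.lt_succ_iff_lt_or_eq.1 haj with h | h
    · exact hj.2 a ha h
    · exact hc a h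
  obtain ⟨j, rfl, hne⟩ := hjn
  refine ⟨j, hij, ?_, hj, lt_of_le_of_ne (hj.apply_le h (by omega)) hne⟩
  by_contra hc
  exact hl ⟨hj.1, fun a ha hal => hj.2 a ha (by omega)⟩

/-- Lexicographic comparison of the components from `q` on. -/
def TailLT (q : ℕ) (a b : Index r) : Prop :=
  ∃ j : Fin n, q ≤ j.val ∧ (∀ i : Fin n, q ≤ i.val → i < j → a i = b i) ∧ a j < b j

theorem eq_iff_agreeUpTo_and_not_tailLT (h : v ≤ e) {q : ℕ} (hq : s ≤ q) :
    e = v ↔ AgreeUpTo s q (idx e) (idx v) ∧ ¬ TailLT q (idx e) (idx v) := by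
  constructor
  · rintro rfl
    exact ⟨⟨rfl, fun _ _ _ => rfl⟩, fun ⟨j, _, _, hj⟩ => lt_irrefl _ hj⟩
  · rintro ⟨h1, h2⟩
    by_cases hn : AgreeUpTo s n (idx e) (idx v)
    · rw [← var_idx e, var_eq_iff]
      exact ⟨hn.1, fun i hi => hn.2 i hi i.2⟩
    · obtain ⟨j, hj, -, hT, hlt⟩ := h1.exists_lt h hq hn
      exact absurd ⟨j, hj, fun i hi hij => hT.2 i (by omega) hij, hlt⟩ h2

end Order

/-! ### Constraints on pairs of factors of a standard monomial. -/

section Standard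

/-- Monomials divisible by no leading monomial of an element of the Gröbner basis. -/
def IsStandard (s t : ℕ) (S : Set (Index r)) (m : Var r s →₀ ℕ) : Prop :=
  ∀ (K : Finset (Fin n)) (a b : Index r), (∀ i ∈ K, i.val < t) → ConnectedIn S a b →
    var s a < var s (sw K a b) → var s a < var s (sw K b a) →
      ¬ Finsupp.single (var s a) 1 + Finsupp.single (var s b) 1 ≤ m

variable {s t : ℕ} {S : Set (Index r)} {m : Var r s →₀ ℕ} {v e : Var r s}

theorem IsStandard.false_of_sw (hm : IsStandard s t S m) (hS : IsSwitchable s t S)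
    (hr : ∀ i, 2 ≤ r i) (ht : 1 ≤ t) (hve : v ≠ e) (hv : m v ≠ 0) (he : m e ≠ 0)
    (hc : ConnectedIn S (idx v) (idx e)) {K : Finset (Fin n)} (hK : ∀ i ∈ K, i.val < t)
    {a b : Index r} (ha : SEquiv s a (idx v)) (hb : SEquiv s b (idx e))
    (h1 : v < var s (sw K a b)) (h2 : v < var s (sw K b a)) : False := by
  classical
  obtain rfl := var_eq_iff.2 ha
  obtain rfl := var_eq_iff.2 hb
  have hca := hS.connectedIn_of_sEquiv hr ht hc.1 ha.symm
  have hcb := hS.connectedIn_of_sEquiv hr ht hc.2.1 hb.symm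
  refine hm K a b hK ((hca.symm.trans hc).trans hcb) h1 h2 fun i => ?_
  simp only [Finsupp.add_apply, Finsupp.single_apply]
  split_ifs with h h' h'
  · exact absurd (h.trans h'.symm) hve
  · subst h; omega
  · subst h'; omega
  · omega

/-- With a gap of two or more, suitable representatives switched at `p` have both head sums below
that of `v`, giving a forbidden pair. -/
theorem IsStandard.headSum_le (hm : IsStandard s t S m) (hS : IsSwitchable s t S)
    (hr : ∀ i, 2 ≤ r i) (hsn : s ≤ n) (ht : 1 ≤ t) (hs : 2 ≤ s) (hv : m v ≠ 0) (he : m e ≠ 0)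
    (hc : ConnectedIn S (idx v) (idx e)) : headSum s (idx v) ≤ headSum s (idx e) + 1 := by
  by_contra h
  obtain ⟨p, hp⟩ : ∃ p : Fin n, p.val = 0 := ⟨⟨0, by omega⟩, rfl⟩
  have hps : p.val < s := by omega
  obtain ⟨a, b, ha, hb, h1, h2⟩ := exists_sEquiv_of_add_two_le (a := idx v) (b := idx e) hps (hr p)
    (one_le_restMax hr hs hsn hp) (by omega)
  have hab := headSum_sw hps (Finset.mem_singleton_self p) (by simp) a b
  have hba := headSum_sw hps (Finset.mem_singleton_self p) (by simp) b a
  rw [ha.headSum_eq, hb.headSum_eq] at *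
  refine hm.false_of_sw hS hr ht (by rintro rfl; omega) hv he hc (K := {p}) (by simp; omega) ha hb
    ?_ ?_
  · have := var_lt_of_headSum_lt (s := s) (a := sw {p} a b) (b := idx v) (by omega)
    rwa [var_idx] at this
  · have := var_lt_of_headSum_lt (s := s) (a := sw {p} b a) (b := idx v) (by omega)
    rwa [var_idx] at this

/-- Switch position `j`. The switch of `v` drops at `j`; the switch of `e` stays below `v` because
of the earlier disagreement. -/
theorem IsStandard.agreeUpTo_of_apply_lt (hm : IsStandard s t S m) (hS : IsSwitchable s t S)
    (hr : ∀ i, 2 ≤ r i) (ht : 1 ≤ t) (hv : m v ≠ 0) (he : m e ≠ 0)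
    (hc : ConnectedIn S (idx v) (idx e)) (hve : v ≤ e) {j : Fin n} (hsj : s ≤ j.val)
    (hjt : j.val < t) (hlt : idx e j < idx v j) : AgreeUpTo s j (idx e) (idx v) := by
  by_contra hT
  have hj : ∀ i ∈ ({j} : Finset (Fin n)), s ≤ i.val := by simpa using hsj
  refine hm.false_of_sw hS hr ht (by rintro rfl; exact lt_irrefl _ hlt) hv he hc (K := {j})
    (by simpa using hjt) (.refl s _) (.refl s _) ?_ ?_
  · have := var_lt_of_tail_lt (s := s) (a := sw {j} (idx v) (idx e)) (b := idx v)
      (headSum_sw_of_le hj _ _) hsj (fun i _ hi => by simp [sw, hi.ne]) (by simpa [sw] using hlt)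
    rwa [var_idx] at this
  · have hhs : headSum s (sw {j} (idx e) (idx v)) = headSum s (idx e) := headSum_sw_of_le hj _ _
    rcases (headSum_idx_le hve).lt_or_eq with h | h
    · have := var_lt_of_headSum_lt (s := s) (hhs.trans_lt h)
      rwa [var_idx] at this
    · obtain ⟨i, hi, hij, hTi, hlti⟩ := AgreeUpTo.exists_lt hve le_rfl
        (i := s) ⟨h, fun i h1 h2 => by omega⟩ hT
      have hij' : i < j := hij
      have := var_lt_of_tail_lt (s := s) (hhs.trans h) hi
        (fun l hl hli => by rw [← hTi.2 l hl hli]; simp [sw, (hli.trans hij').ne])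
        (by simpa [sw, hij'.ne] using hlti)
      rwa [var_idx] at this

/-- Exchange the head sums and all entries at positions from `s` up to `max s t`. One result is
below `v` by the earlier disagreement, the other agrees with `v` there and is below it by its tail.
-/
theorem IsStandard.agreeUpTo_of_tailLT (hm : IsStandard s t S m) (hS : IsSwitchable s t S)
    (hr : ∀ i, 2 ≤ r i) (hs : 1 ≤ s) (hsn : s ≤ n) (ht : 1 ≤ t) (hv : m v ≠ 0) (he : m e ≠ 0)
    (hc : ConnectedIn S (idx v) (idx e)) (hve : v ≤ e)
    (hlt : TailLT (max s t) (idx e) (idx v)) : AgreeUpTo s (max s t) (idx e) (idx v) := by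
  classical
  by_contra hT
  obtain ⟨p, hp⟩ : ∃ p : Fin n, p.val = 0 := ⟨⟨0, by omega⟩, rfl⟩
  have hps : p.val < s := by omega
  have hle := headSum_idx_le hve
  obtain ⟨a, b, ha, hb, hpab⟩ := exists_sEquiv_of_le_add_one (a := idx v) (b := idx e) hps (hr p) hle (by
    rcases hs.eq_or_lt with h | h
    · subst h; exact .inl (restMax_one hp)
    · exact .inr (hm.headSum_le hS hr hsn ht h hv he hc))
  -- Of the head only `p` is switched: the representatives are chosen so that this alone
  -- interchanges the head sums.
  let K : Finset (Fin n) := Finset.univ.filter fun i => i.val < t ∧ (i = p ∨ s ≤ i.val)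
  have hK : ∀ i, i ∈ K ↔ i.val < t ∧ (i = p ∨ s ≤ i.val) := by simp [K]
  have hpK : p ∈ K := (hK p).2 ⟨by omega, .inl rfl⟩
  have hKs : ∀ i ∈ K, i.val < s → i = p := fun i hi his =>
    ((hK i).1 hi).2.resolve_right (by omega)
  have hab := headSum_sw hps hpK hKs a b
  have hba := headSum_sw hps hpK hKs b a
  rw [ha.headSum_eq] at hab
  rw [hb.headSum_eq] at hba
  have hsab : headSum s (sw K a b) = headSum s (idx e) := by omega
  have hsba : headSum s (sw K b a) = headSum s (idx v) := by omega
  obtain ⟨j, hj, hjeq, hjlt⟩ := hlt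
  have hne : v ≠ e := by rintro rfl; exact lt_irrefl _ hjlt
  refine hm.false_of_sw hS hr ht hne hv he hc (fun i hi => ((hK i).1 hi).1) ha hb ?_ ?_
  · rcases hle.lt_or_eq with h | h
    · have := var_lt_of_headSum_lt (s := s) (hsab.trans_lt h)
      rwa [var_idx] at this
    · obtain ⟨i, hi, hij, hTi, hlti⟩ := AgreeUpTo.exists_lt hve le_rfl
        (i := s) ⟨h, fun i h1 h2 => by omega⟩ hT
      have hmem : ∀ l : Fin n, s ≤ l.val → l ≤ i → l ∈ K := fun l hl hli =>
        (hK l).2 ⟨by have : l.val ≤ i.val := hli; omega, .inr hl⟩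
      have := var_lt_of_tail_lt (s := s) (a := sw K a b) (b := idx v) (hsab.trans h) hi
        (fun l hl hli => by rw [sw_apply_of_mem (hmem l hl hli.le), hb.2 l hl, hTi.2 l hl hli])
        (by rw [sw_apply_of_mem (hmem i hi le_rfl), hb.2 i hi]; exact hlti)
      rwa [var_idx] at this
  · have := var_lt_of_tail_lt (s := s) (a := sw K b a) (b := idx v) (j := j) hsba (by omega)
      (fun l hl hlj => by
        by_cases hlt : l.val < t
        · rw [sw_apply_of_mem ((hK l).2 ⟨hlt, .inr hl⟩), ha.2 l hl]
        · rw [sw_apply_of_notMem fun h => hlt ((hK l).1 h).1, hb.2 l hl, hjeq l (by omega) hlj])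
      (by
        rw [sw_apply_of_notMem fun h => by have := ((hK j).1 h).1; omega, hb.2 j (by omega)]
        exact hjlt)
    rwa [var_idx] at this

end Standard

/-! ### Construction of invariant weights. -/

section Invariants

variable {s t : ℕ} {S : Set (Index r)}

-- All four indices in a generator lie in one component, so a conserved quantity may be restricted
-- to a single component.
open Classical in
theorem isInvariant_ite_connectedIn (hS : IsSwitchable s t S) (hr : ∀ i, 2 ≤ r i) (ht : 1 ≤ t)
    (c : Index r) (g : Index r → ℤ) (hg : ∀ a b, SEquiv s a b → g a = g b)
    (hgs : ∀ (i : Fin n) (a b : Index r), i.val < t →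
      g a + g b = g (sw {i} a b) + g (sw {i} b a)) :
    IsInvariant s t S fun e => if ConnectedIn S c (idx e) then g (idx e) else 0 := by
  intro i a b hi hab
  have key : ∀ d, ConnectedIn S a d →
      (if ConnectedIn S c (idx (var s d)) then g (idx (var s d)) else 0) =
        if ConnectedIn S c a then g d else 0 := fun d hd => by
    have h1 := hS.connectedIn_of_sEquiv hr ht hd.2.1 (idx_var_sEquiv s d).symm
    have h2 : ConnectedIn S c (idx (var s d)) ↔ ConnectedIn S c a :=
      ⟨fun h => (h.trans h1.symm).trans hd.symm, fun h => (h.trans hd).trans h1⟩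
    simp only [h2, hg _ _ (idx_var_sEquiv s d)]
  have hsw := hS.connectedIn_sw_singleton hab hi
  have hsw' := hab.trans (hS.connectedIn_sw_singleton hab.symm hi)
  beta_reduce
  rw [key a (.refl hab.1), key b hab, key _ hsw, key _ hsw']
  split_ifs
  · exact hgs i a b hi
  · simp

theorem isInvariant_of_notMem (hS : IsSwitchable s t S) {v : Var r s} (hv : idx v ∉ S) :
    IsInvariant s t S fun e => if e = v then 1 else 0 := by
  intro i a b hi hab
  have key : ∀ d ∈ S, var s d ≠ v := fun d hd h =>
    hv (hS.sEquiv_mem d hd _ (var_eq_iff.1 h).symm)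
  have hsw := hS.connectedIn_sw_singleton hab hi
  have hsw' := hS.connectedIn_sw_singleton hab.symm hi
  simp [key a hab.1, key b hab.2.1, key _ hsw.2.1, key _ hsw'.2.1]

end Invariants

/-! ### Comparison of counts. -/

section Counting

variable {σ : Type*} (W : Finset σ) (m m' : σ → ℕ)

open Classical in
/-- The total multiplicity of the elements of `W` with the property `P`. -/
def count (P : σ → Prop) : ℤ := ∑ e ∈ W, (m e : ℤ) * if P e then 1 else 0

variable {W m m'}

theorem count_eq_sum (P : σ → Prop) [DecidablePred P] :
    count W m P = ∑ e ∈ W, (m e : ℤ) * if P e then 1 else 0 :=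
  Finset.sum_congr rfl fun e _ => by congr

/-- Removing `P` from `T` costs `m` the full count of `P`, since its factors with `P` all lie in
`T`; it costs `m'` at most the same number. -/
theorem count_le_count_of_refine {T P T' : σ → Prop} (hT : count W m T ≤ count W m' T)
    (hP : count W m P = count W m' P) (hPT : ∀ e ∈ W, m e ≠ 0 → P e → T e)
    (hT' : ∀ e ∈ W, T' e ↔ T e ∧ ¬ P e) : count W m T' ≤ count W m' T' := by
  classical
  have h1 : count W m T' + count W m P ≤ count W m T := by
    simp only [count, ← Finset.sum_add_distrib]
    refine Finset.sum_le_sum fun e he => ?_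
    by_cases hm : m e = 0
    · simp [hm]
    have := hPT e he hm
    have hpos : (0 : ℤ) ≤ m e := by positivity
    simp only [hT' e he]
    by_cases hPe : P e <;> by_cases hTe : T e <;> simp_all
  have h2 : count W m' T ≤ count W m' T' + count W m' P := by
    simp only [count, ← Finset.sum_add_distrib]
    refine Finset.sum_le_sum fun e he => ?_
    have hpos : (0 : ℤ) ≤ m' e := by positivity
    simp only [hT' e he]
    by_cases hPe : P e <;> by_cases hTe : T e <;> simp_all
  omega

theorem count_eq {v : σ} (hv : v ∈ W) : count W m (fun e => e = v) = m v := by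
  classical
  simp [count, hv]

end Counting

section Column

variable {s : ℕ}

open Classical in
theorem column_switch (j i : Fin n) (c a b : Index r) :
    (if a j < c j then (1 : ℤ) else 0) + (if b j < c j then 1 else 0) =
      (if sw {i} a b j < c j then 1 else 0) + (if sw {i} b a j < c j then 1 else 0) := by
  by_cases h : j = i
  · subst h; simp only [sw, Finset.mem_singleton, if_true]; ring
  · simp [sw, h]

theorem tailLT_sw {q : ℕ} {i : Fin n} (hi : i.val < q) (a b c : Index r) :
    TailLT q (sw {i} a b) c ↔ TailLT q a c := by
  have h : ∀ l : Fin n, q ≤ l.val → sw {i} a b l = a l := fun l hl =>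
    sw_apply_of_notMem (by simp; rintro rfl; omega) a b
  refine exists_congr fun j => and_congr_right fun hj => ?_
  rw [h j hj]
  refine and_congr_left fun _ => forall_congr' fun l => forall_congr' fun hl => ?_
  rw [h l hl]

theorem tailLT_congr {q : ℕ} (hq : s ≤ q) {a b : Index r} (h : SEquiv s a b) (c : Index r) :
    TailLT q a c ↔ TailLT q b c := by
  refine exists_congr fun j => and_congr_right fun hj => ?_
  rw [h.2 j (hq.trans hj)]
  refine and_congr_left fun _ => forall_congr' fun l => forall_congr' fun hl => ?_
  rw [h.2 l (hq.trans hl)]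

end Column

/-! ### Minimality of standard monomials. -/

section Minimality

variable {s t : ℕ} {S : Set (Index r)} {m m' : Var r s →₀ ℕ} {v : Var r s}

/-- Congruent monomials agreeing above `v` have the same weights below `v` in the connected
component of `v`. -/
theorem Congruent.sum_eq (hc : Congruent s t S m m') (hS : IsSwitchable s t S)
    (hr : ∀ i, 2 ≤ r i) (ht : 1 ≤ t) (hlt : ∀ w < v, m' w = m w) {W : Finset (Var r s)}
    (hW : ∀ e, e ∈ W ↔ v ≤ e ∧ ConnectedIn S (idx v) (idx e)) (g : Index r → ℤ)
    (hg : ∀ a b, SEquiv s a b → g a = g b)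
    (hgs : ∀ (i : Fin n) (a b : Index r), i.val < t →
      g a + g b = g (sw {i} a b) + g (sw {i} b a)) :
    ∑ e ∈ W, (m e : ℤ) * g (idx e) = ∑ e ∈ W, (m' e : ℤ) * g (idx e) := by
  classical
  have h := hc _ (isInvariant_ite_connectedIn hS hr ht (idx v) g hg hgs)
  have key : ∀ q : Var r s →₀ ℕ,
      weight (fun e => if ConnectedIn S (idx v) (idx e) then g (idx e) else 0) q =
        ∑ e ∈ W, (q e : ℤ) * g (idx e) + ∑ e with e < v,
          (q e : ℤ) * if ConnectedIn S (idx v) (idx e) then g (idx e) else 0 := fun q => by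
    have : W = (Finset.univ.filter fun e => ¬ e < v).filter
        fun e => ConnectedIn S (idx v) (idx e) := by
      ext e; simp [hW]
    rw [weight, ← Finset.sum_filter_add_sum_filter_not _ (fun e => e < v), add_comm, this,
      Finset.sum_filter (fun e => ConnectedIn S (idx v) (idx e))]
    simp only [mul_ite, mul_zero]
  have hrest : ∑ e with e < v, (m' e : ℤ) *
        (if ConnectedIn S (idx v) (idx e) then g (idx e) else 0) =
      ∑ e with e < v, (m e : ℤ) * if ConnectedIn S (idx v) (idx e) then g (idx e) else 0 :=
    Finset.sum_congr rfl fun e he => by rw [hlt e (Finset.mem_filter.1 he).2]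
  rw [key, key, hrest] at h
  exact add_right_cancel h

/-- A standard monomial is the smallest one in its congruence class. -/
theorem IsStandard.not_congruent (hm : IsStandard s t S m) (hS : IsSwitchable s t S)
    (hr : ∀ i, 2 ≤ r i) (hs : 1 ≤ s) (hsn : s ≤ n) (ht : 1 ≤ t) (htn : t ≤ n)
    (hlt : ∀ w < v, m' w = m w) (hv : m' v < m v) : ¬ Congruent s t S m m' := by
  classical
  intro hc
  by_cases hvS : idx v ∈ S
  swap
  -- A variable outside `S` occurs in no generator, so its exponent is itself invariant.
  · have h := hc _ (isInvariant_of_notMem hS hvS)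
    simp only [weight, mul_ite, mul_one, mul_zero, Finset.sum_ite_eq', Finset.mem_univ,
      if_true] at h
    omega
  have hv0 : m v ≠ 0 := by omega
  obtain ⟨p, hp⟩ : ∃ p : Fin n, p.val = 0 := ⟨⟨0, by omega⟩, rfl⟩
  set W : Finset (Var r s) :=
    Finset.univ.filter fun e => v ≤ e ∧ ConnectedIn S (idx v) (idx e) with hWdef
  have hW : ∀ e, e ∈ W ↔ v ≤ e ∧ ConnectedIn S (idx v) (idx e) := by simp [hWdef]
  have hsum := hc.sum_eq hS hr ht hlt hW
  have hcol : ∀ j : Fin n, (∀ a b : Index r, SEquiv s a b → a j = b j) →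
      count W m (fun e => idx e j < idx v j) = count W m' fun e => idx e j < idx v j :=
    fun j hj => by
      rw [count_eq_sum, count_eq_sum]
      exact hsum (fun a => if a j < idx v j then 1 else 0)
        (fun a b hab => by simp only [hj a b hab])
        fun i a b _ => by convert column_switch j i (idx v) a b
  have hstart : count W m (fun e => AgreeUpTo s s (idx e) (idx v)) ≤
      count W m' fun e => AgreeUpTo s s (idx e) (idx v) := by
    have hiff : ∀ a b : Index r, AgreeUpTo s s a b ↔ headSum s a = headSum s b := fun a b =>
      ⟨fun h => h.1, fun h => ⟨h, fun i h1 h2 => absurd h1 (not_le.2 h2)⟩⟩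
    simp only [hiff]
    -- For `s = 1` the head sum is a single entry with conserved distribution; otherwise only the
    -- total head sum is conserved.
    rcases hs.eq_or_lt with h1 | h2
    · subst h1
      refine count_le_count_of_refine (T := fun _ => True)
        (by
          rw [count_eq_sum, count_eq_sum]
          exact le_of_eq (hsum (fun _ => if True then 1 else 0) (fun _ _ _ => rfl)
            fun _ _ _ _ => rfl))
        (hcol p fun a b hab => Fin.ext ?_) (fun _ _ _ _ => trivial) fun e he => ?_
      · rw [← headSum_one hp, ← headSum_one hp, hab.headSum_eq]
      · have := headSum_idx_le ((hW e).1 he).1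
        rw [headSum_one hp, headSum_one hp] at *
        rw [Fin.lt_def, true_and]
        omega
    -- Head sums in `W` do not exceed that of `v`, so this function is at most the indicator of
    -- equality. On the factors of `m` the gap is at most one, and it equals the indicator.
    · have h := hsum (fun a => (headSum s a : ℤ) - headSum s (idx v) + 1)
        (fun a b hab => by simp only [hab.headSum_eq]) fun i a b _ => by
          have := headSum_sw_add (s := s) i a b
          omega
      refine (Finset.sum_le_sum fun e he => ?_).trans
        (h.le.trans (Finset.sum_le_sum fun e he => ?_))
      · by_cases hme : m e = 0
        · simp [hme]
        have := hm.headSum_le hS hr hsn ht h2 hv0 hme ((hW e).1 he).2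
        refine mul_le_mul_of_nonneg_left ?_ (by positivity)
        split_ifs <;> omega
      · have := headSum_idx_le ((hW e).1 he).1
        refine mul_le_mul_of_nonneg_left ?_ (by positivity)
        split_ifs <;> omega
  have hall : ∀ j, s ≤ j → j ≤ max s t → count W m (fun e => AgreeUpTo s j (idx e) (idx v)) ≤
      count W m' fun e => AgreeUpTo s j (idx e) (idx v) := by
    intro j hj
    induction j, hj using Nat.le_induction with
    | base => exact fun _ => hstart
    | succ j hj ih =>
      intro hjt
      obtain ⟨j, rfl⟩ : ∃ i : Fin n, i.val = j := ⟨⟨j, by omega⟩, rfl⟩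
      refine count_le_count_of_refine (ih (by omega)) (hcol j fun a b hab => hab.2 j hj)
        (fun e he hme hlt => hm.agreeUpTo_of_apply_lt hS hr ht hv0 hme ((hW e).1 he).2
          ((hW e).1 he).1 hj (by omega) hlt) fun e he => ?_
      constructor
      · intro h
        refine ⟨⟨h.1, fun i h1 h2 => h.2 i h1 (by omega)⟩, ?_⟩
        rw [h.2 j hj (by omega)]
        exact lt_irrefl _
      · rintro ⟨h1, h2⟩
        refine ⟨h1.1, fun i hi hij => ?_⟩
        rcases Nat.lt_succ_iff_lt_or_eq.1 hij with h | h
        · exact h1.2 i hi h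
        · obtain rfl : i = j := Fin.ext h
          exact le_antisymm (h1.apply_le ((hW e).1 he).1 hj) (not_lt.1 h2)
  have hend : count W m (fun e => e = v) ≤ count W m' fun e => e = v := by
    refine count_le_count_of_refine (hall _ (le_max_left s t) le_rfl)
      (P := fun e => TailLT (max s t) (idx e) (idx v))
      (hsum (fun a => if TailLT (max s t) a (idx v) then 1 else 0)
        (fun a b hab => by simp only [tailLT_congr (le_max_left s t) hab])
        fun i a b hi => by simp only [tailLT_sw (lt_of_lt_of_le hi (le_max_right s t))])
      (fun e he hme hlt => hm.agreeUpTo_of_tailLT hS hr hs hsn ht hv0 hme ((hW e).1 he).2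
          ((hW e).1 he).1 hlt)
      fun e he => eq_iff_agreeUpTo_and_not_tailLT ((hW e).1 he).1 (le_max_left s t)
  have hvW : v ∈ W := (hW v).2 ⟨le_rfl, .refl hvS⟩
  rw [count_eq hvW, count_eq hvW] at hend
  omega

theorem not_isStandard_degree {k : Type*} [Field k] (hS : IsSwitchable s t S)
    (hr : ∀ i, 2 ≤ r i) (hs : 1 ≤ s) (hsn : s ≤ n) (ht : 1 ≤ t) (htn : t ≤ n)
    {g : MvPolynomial (Var r s) k} (hg : g ∈ tildeIdeal k s t S) (hg0 : g ≠ 0) :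
    ¬ IsStandard s t S (MonomialOrder.lex.degree g) := by
  intro hm
  obtain ⟨m', hm', hne, hc⟩ :=
    exists_congruent_of_mem_tildeIdeal hg (MonomialOrder.lex.degree_mem_support hg0)
  have hle := MonomialOrder.lex.le_degree hm'
  have hlt := lt_of_le_of_ne hle fun h => hne (MonomialOrder.lex.toSyn.injective h)
  rw [MonomialOrder.lex_lt_iff, Finsupp.Lex.lt_iff] at hlt
  obtain ⟨v, h1, h2⟩ := hlt
  exact hm.not_congruent hS hr hs hsn ht htn h1 h2 hc

end Minimality

end HankelHypermatrix

end

theorem mainTheorem2 {k : Type*} [Field k] {n : ℕ} (r : Fin n → ℕ) (hr : ∀ i, 2 ≤ r i)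
    (s t : ℕ) (hs : 1 ≤ s) (hsn : s ≤ n) (ht : 1 ≤ t) (htn : t ≤ n)
    (S : Set (HankelHypermatrix.Index r)) (hS : HankelHypermatrix.IsSwitchable s t S) :
    HankelHypermatrix.IsGroebnerBasis
      (MonomialOrder.lex (σ := HankelHypermatrix.Var r s))
      (HankelHypermatrix.tildeIdeal k s t S)
      (HankelHypermatrix.groebnerSet k s t S) := by
  open HankelHypermatrix in
  refine ⟨groebnerSet_finite k, span_groebnerSet k hS, le_antisymm ?_ (Ideal.span_le.2 ?_)⟩
  · refine Ideal.span_mono (Set.image_mono ?_)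
    rw [← span_groebnerSet k hS]
    exact Ideal.subset_span
  · rintro _ ⟨g, hg, rfl⟩
    by_cases hg0 : g = 0
    · simp [hg0]
    have hns := not_isStandard_degree hS hr hs hsn ht htn hg hg0
    simp only [IsStandard, not_forall, not_not] at hns
    obtain ⟨K, a, b, hK, hab, h1, h2, hle⟩ := hns
    obtain ⟨d, hd⟩ := exists_add_of_le hle
    have hlt := leadingTerm_f k h1 h2
    have hfac : MonomialOrder.lex.leadingTerm g =
        MvPolynomial.monomial d (MonomialOrder.lex.leadingCoeff g) *
          MonomialOrder.lex.leadingTerm (f k s K a b) := by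
      rw [hlt, MvPolynomial.monomial_mul, mul_one, add_comm d, ← hd, MonomialOrder.leadingTerm]
    rw [hfac]
    exact Ideal.mul_mem_left _ _ (Ideal.subset_span ⟨_, ⟨K, a, b, hK, hab, rfl⟩, rfl⟩)
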